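/- Fix an integer $\Delta \ge 0$. Let $\mathbf{Gr}$ be the space of isomorphism classes $[G,o]$ of countable connected rooted graphs (simple, undirected) with all degrees at most $\Delta$, with the metric $\rho([G,o],[H,p]) = 2^{-r}$ for $[G,o]\neq[H,p]$, where $r$ is the supremum of the integers $s\ge 0$ such that the balls $B_G(o,s)$ and $B_H(p,s)$ are isomorphic as rooted graphs. Let $\vec{\mathbf{Gr}}$ be the space of isomorphism classes $[G,o_1,o_2]$ of countable connected graphs with all degrees at most $\Delta$ and with an ordered pair of adjacent vertices $o_1,o_2$, with the analogous metric (balls around $o_1$, isomorphisms preserving both roots). Both carry their Borel $\sigma$-algebras. A probability measure $\nu$ on $\mathbf{Gr}$ is *unimodular* if $$\int \sum_{x\in N_G(o)} f[G,x,o]\,d\nu[G,o] = \int \sum_{x\in N_G(o)} f[G,o,x]\,d\nu[G,o]$$ in $[0,\infty]$ for every Borel function $f:\vec{\mathbf{Gr}}\to[0,\infty)$, where $N_G(o)$ is the set of neighbours of $o$. Let $X$ be a measurable space in which some countable family of measurable sets separates points (for example a standard Borel space), let $\mu$ be a probability measure on $X$, and let $\mathcal{G}=(X,i_1,\dots,i_k,\mu)$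 be a measurable graphing, i.e. each $i_j:X\to X$ is a measurable, $\mu$-preserving map with $i_j\circ i_j=\mathrm{id}$. Its leafgraph $\mathcal{L}$ is the graph on $X$ in which distinct points $x,y$ are adjacent if and only if $y=i_j(x)$ for some $j$. Assume that all degrees in $\mathcal{L}$ are at most $\Delta$ (for instance $k\le\Delta$), and let $\mathcal{L}_x$ denote the connected component of $x$ in $\mathcal{L}$. Then the map $x\mapsto[\mathcal{L}_x,x]$ from $X$ to $\mathbf{Gr}$ is measurable, and the law $\Psi(\mathcal{G})$ of $\mathcal{G}$, i.e. the push-forward of $\mu$ under this map, is a unimodular probability measure on $\mathbf{Gr}$. -/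

import Mathlib

open MeasureTheory
open scoped NNReal ENNReal

universe u

noncomputable section

/-! ## Rooted and birooted graphs -/

/-- A countable, connected rooted graph `(G, o)` all of whose vertices have degree at most `Δ`.
The vertex types range over an arbitrary universe `u`; up to isomorphism every universe contains
the same countable graphs. -/
structure RootedGraph (Δ : ℕ) : Type (u + 1) where
  V : Type u
  graph : SimpleGraph V
  root : V
  countable : Countable V
  connected : graph.Connected
  degree_le : ∀ v : V, (graph.neighborSet v).encard ≤ (Δ : ℕ∞)

/-- A countable, connected birooted graph `(G, o₁, o₂)`: the second root is a neighbour of the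
first one, and all vertices have degree at most `Δ`. -/
structure BirootedGraph (Δ : ℕ) : Type (u + 1) extends RootedGraph.{u} Δ where
  root₂ : V
  adj : graph.Adj root root₂

namespace RootedGraph

variable {Δ : ℕ}

/-- The vertex set of the ball `B_G(o, s)`: all vertices at graph distance at most `s` from the
root. -/
def ballSet (G : RootedGraph.{u} Δ) (s : ℕ) : Set G.V := {v | G.graph.dist G.root v ≤ s}

/-- Isomorphism of rooted graphs. -/
def Iso (G H : RootedGraph.{u} Δ) : Prop :=
  ∃ e : G.graph ≃g H.graph, e G.root = H.root

/-- `[B_G(o, s), o] = [B_H(p, s), p]`: the induced balls of radius `s` around the roots are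
isomorphic as rooted graphs. -/
def BallIso (s : ℕ) (G H : RootedGraph.{u} Δ) : Prop :=
  ∃ e : G.graph.induce (G.ballSet s) ≃g H.graph.induce (H.ballSet s),
    ∀ v : G.ballSet s, (v : G.V) = G.root ↔ (e v : H.V) = H.root

instance setoid (Δ : ℕ) : Setoid (RootedGraph.{u} Δ) where
  r := Iso
  iseqv :=
    { refl := fun G => ⟨SimpleGraph.Iso.refl, rfl⟩
      symm := by
        rintro G H ⟨e, he⟩
        exact ⟨e.symm, by rw [← he]; exact e.symm_apply_apply _⟩
      trans := by
        rintro G H K ⟨e, he⟩ ⟨f, hf⟩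
        exact ⟨e.trans f, by rw [← hf, ← he]; rfl⟩ }

theorem BallIso.symm {s : ℕ} {G H : RootedGraph.{u} Δ} (h : BallIso s G H) : BallIso s H G := by
  obtain ⟨e, he⟩ := h
  refine ⟨e.symm, fun v => ?_⟩
  have h1 := he (e.symm v)
  rw [e.apply_symm_apply] at h1
  exact h1.symm

theorem BallIso.trans {s : ℕ} {G H K : RootedGraph.{u} Δ} (h : BallIso s G H)
    (h' : BallIso s H K) : BallIso s G K := by
  obtain ⟨e, he⟩ := h
  obtain ⟨f, hf⟩ := h'
  exact ⟨e.trans f, fun v => (he v).trans (hf (e v))⟩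

end RootedGraph

/-- Graph isomorphisms preserve the graph distance. -/
theorem SimpleGraph.Iso.dist_apply_apply {V W : Type u} {G : SimpleGraph V} {H : SimpleGraph W}
    (hG : G.Connected) (hH : H.Connected) (e : G ≃g H) (a b : V) :
    H.dist (e a) (e b) = G.dist a b := by
  apply le_antisymm
  · obtain ⟨p, hp⟩ := hG.exists_walk_length_eq_dist a b
    rw [← hp, ← SimpleGraph.Walk.length_map e.toHom p]
    exact SimpleGraph.dist_le _
  · obtain ⟨p, hp⟩ := hH.exists_walk_length_eq_dist (e a) (e b)
    rw [← hp, ← SimpleGraph.Walk.length_map e.symm.toHom p]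
    have := SimpleGraph.dist_le (p.map e.symm.toHom)
    simpa using this

namespace RootedGraph

variable {Δ : ℕ}

/-- A rooted isomorphism restricts to isomorphisms of balls. -/
def isoBall {G H : RootedGraph.{u} Δ} (e : G.graph ≃g H.graph) (he : e G.root = H.root) (s : ℕ) :
    G.graph.induce (G.ballSet s) ≃g H.graph.induce (H.ballSet s) where
  toEquiv := e.toEquiv.subtypeEquiv (fun a => by
    change G.graph.dist G.root a ≤ s ↔ H.graph.dist H.root (e a) ≤ s
    rw [← he, e.dist_apply_apply G.connected H.connected])
  map_rel_iff' := by
    intro a b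
    exact e.map_adj_iff

theorem Iso.ballIso {G H : RootedGraph.{u} Δ} (h : Iso G H) (s : ℕ) : BallIso s G H := by
  obtain ⟨e, he⟩ := h
  refine ⟨isoBall e he s, fun v => ?_⟩
  change (v : G.V) = G.root ↔ e v = H.root
  rw [← he]
  exact e.injective.eq_iff.symm

end RootedGraph

namespace BirootedGraph

variable {Δ : ℕ}

/-- Isomorphism of birooted graphs. -/
def Iso (G H : BirootedGraph.{u} Δ) : Prop :=
  ∃ e : G.graph ≃g H.graph, e G.root = H.root ∧ e G.root₂ = H.root₂

/-- `[B_G(o₁, s), o₁, o₂] = [B_H(p₁, s), p₁, p₂]`: the induced balls of radius `s` around the first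
roots are isomorphic as birooted graphs. (For `s ≥ 1` the second root lies in the ball; for `s = 0`
it does not, and the condition on it is void.) -/
def BallIso (s : ℕ) (G H : BirootedGraph.{u} Δ) : Prop :=
  ∃ e : G.graph.induce (G.ballSet s) ≃g H.graph.induce (H.ballSet s),
    (∀ v : G.ballSet s, (v : G.V) = G.root ↔ (e v : H.V) = H.root) ∧
    (∀ v : G.ballSet s, (v : G.V) = G.root₂ ↔ (e v : H.V) = H.root₂)

instance setoid (Δ : ℕ) : Setoid (BirootedGraph.{u} Δ) where
  r := Iso
  iseqv :=
    { refl := fun G => ⟨SimpleGraph.Iso.refl, rfl, rfl⟩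
      symm := by
        rintro G H ⟨e, he, he'⟩
        exact ⟨e.symm, by rw [← he]; exact e.symm_apply_apply _,
          by rw [← he']; exact e.symm_apply_apply _⟩
      trans := by
        rintro G H K ⟨e, he, he'⟩ ⟨f, hf, hf'⟩
        exact ⟨e.trans f, by rw [← hf, ← he]; rfl, by rw [← hf', ← he']; rfl⟩ }

theorem BallIso.symm {s : ℕ} {G H : BirootedGraph.{u} Δ} (h : BallIso s G H) : BallIso s H G := by
  obtain ⟨e, he, he'⟩ := h
  refine ⟨e.symm, fun v => ?_, fun v => ?_⟩
  · have h1 := he (e.symm v)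
    rw [e.apply_symm_apply] at h1
    exact h1.symm
  · have h1 := he' (e.symm v)
    rw [e.apply_symm_apply] at h1
    exact h1.symm

theorem BallIso.trans {s : ℕ} {G H K : BirootedGraph.{u} Δ} (h : BallIso s G H)
    (h' : BallIso s H K) : BallIso s G K := by
  obtain ⟨e, he, he'⟩ := h
  obtain ⟨f, hf, hf'⟩ := h'
  exact ⟨e.trans f, fun v => (he v).trans (hf (e v)), fun v => (he' v).trans (hf' (e v))⟩

theorem Iso.ballIso {G H : BirootedGraph.{u} Δ} (h : Iso G H) (s : ℕ) : BallIso s G H := by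
  obtain ⟨e, he, he'⟩ := h
  refine ⟨RootedGraph.isoBall e he s, fun v => ?_, fun v => ?_⟩
  · change (v : G.V) = G.root ↔ e v = H.root
    rw [← he]
    exact e.injective.eq_iff.symm
  · change (v : G.V) = G.root₂ ↔ e v = H.root₂
    rw [← he']
    exact e.injective.eq_iff.symm

end BirootedGraph

/-! ## The spaces of isomorphism classes, with their metrics and Borel σ-algebras -/

/-- The space `𝐆𝐫` of isomorphism classes `[G, o]`. -/
def Gr (Δ : ℕ) : Type (u + 1) := Quotient (RootedGraph.setoid.{u} Δ)

/-- The space of isomorphism classes `[G, o₁, o₂]` of birooted graphs. -/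
def BiGr (Δ : ℕ) : Type (u + 1) := Quotient (BirootedGraph.setoid.{u} Δ)

/-- The class `[G, o]`. -/
def RootedGraph.toGr {Δ : ℕ} (G : RootedGraph.{u} Δ) : Gr.{u} Δ := Quotient.mk _ G

/-- The class `[G, o₁, o₂]`. -/
def BirootedGraph.toBiGr {Δ : ℕ} (G : BirootedGraph.{u} Δ) : BiGr.{u} Δ := Quotient.mk _ G

namespace Gr

variable {Δ : ℕ}

/-- Two classes have the same rooted ball of radius `s`. -/
def SameBall (s : ℕ) (a b : Gr.{u} Δ) : Prop :=
  Quotient.liftOn₂ a b (RootedGraph.BallIso s) (fun _ _ _ _ h h' => propext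
    ⟨fun k => ((RootedGraph.Iso.ballIso h s).symm.trans k).trans (RootedGraph.Iso.ballIso h' s),
     fun k => ((RootedGraph.Iso.ballIso h s).trans k).trans
      (RootedGraph.Iso.ballIso h' s).symm⟩)

open Classical in
/-- The metric `ρ`: `0` on the diagonal and otherwise `2 ^ (-r)`, where `r` is the supremum of the
radii `s` for which the balls of radius `s` agree (so `2 ^ (-r)` is the infimum of the
`2 ^ (-s)`). -/
def rho (a b : Gr.{u} Δ) : ℝ :=
  if a = b then 0 else ⨅ s : {s : ℕ // SameBall s a b}, ((2 : ℝ)⁻¹) ^ (s : ℕ)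

/-- The topology induced by `ρ`. -/
instance : TopologicalSpace (Gr.{u} Δ) where
  IsOpen U := ∀ a ∈ U, ∃ ε : ℝ, 0 < ε ∧ ∀ b, rho a b < ε → b ∈ U
  isOpen_univ := fun _ _ => ⟨1, one_pos, fun _ _ => trivial⟩
  isOpen_inter := by
    rintro U W hU hW a ⟨haU, haW⟩
    obtain ⟨ε, hε, h⟩ := hU a haU
    obtain ⟨δ, hδ, h'⟩ := hW a haW
    exact ⟨min ε δ, lt_min hε hδ, fun b hb =>
      ⟨h b (hb.trans_le (min_le_left _ _)), h' b (hb.trans_le (min_le_right _ _))⟩⟩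
  isOpen_sUnion := by
    rintro S hS a ⟨U, hU, haU⟩
    obtain ⟨ε, hε, h⟩ := hS U hU a haU
    exact ⟨ε, hε, fun b hb => ⟨U, hU, h b hb⟩⟩

instance : MeasurableSpace (Gr.{u} Δ) := borel _

instance : BorelSpace (Gr.{u} Δ) := ⟨rfl⟩

end Gr

namespace BiGr

variable {Δ : ℕ}

/-- Two classes have the same birooted ball of radius `s`. -/
def SameBall (s : ℕ) (a b : BiGr.{u} Δ) : Prop :=
  Quotient.liftOn₂ a b (BirootedGraph.BallIso s) (fun _ _ _ _ h h' => propext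
    ⟨fun k => ((BirootedGraph.Iso.ballIso h s).symm.trans k).trans
      (BirootedGraph.Iso.ballIso h' s),
     fun k => ((BirootedGraph.Iso.ballIso h s).trans k).trans
      (BirootedGraph.Iso.ballIso h' s).symm⟩)

open Classical in
/-- The metric on birooted classes: `0` on the diagonal and otherwise `2 ^ (-r)`, where `r` is the
supremum of the radii `s` for which the birooted balls of radius `s` agree. -/
def rho (a b : BiGr.{u} Δ) : ℝ :=
  if a = b then 0 else ⨅ s : {s : ℕ // SameBall s a b}, ((2 : ℝ)⁻¹) ^ (s : ℕ)

/-- The topology induced by the metric `BiGr.rho`. -/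
instance : TopologicalSpace (BiGr.{u} Δ) where
  IsOpen U := ∀ a ∈ U, ∃ ε : ℝ, 0 < ε ∧ ∀ b, rho a b < ε → b ∈ U
  isOpen_univ := fun _ _ => ⟨1, one_pos, fun _ _ => trivial⟩
  isOpen_inter := by
    rintro U W hU hW a ⟨haU, haW⟩
    obtain ⟨ε, hε, h⟩ := hU a haU
    obtain ⟨δ, hδ, h'⟩ := hW a haW
    exact ⟨min ε δ, lt_min hε hδ, fun b hb =>
      ⟨h b (hb.trans_le (min_le_left _ _)), h' b (hb.trans_le (min_le_right _ _))⟩⟩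
  isOpen_sUnion := by
    rintro S hS a ⟨U, hU, haU⟩
    obtain ⟨ε, hε, h⟩ := hS U hU a haU
    exact ⟨ε, hε, fun b hb => ⟨U, hU, h b hb⟩⟩

instance : MeasurableSpace (BiGr.{u} Δ) := borel _

instance : BorelSpace (BiGr.{u} Δ) := ⟨rfl⟩

end BiGr

/-! ## Unimodularity -/

namespace RootedGraph

variable {Δ : ℕ}

/-- The birooted graph `(G, o, x)` for a neighbour `x` of the root `o`. -/
def outEdge (G : RootedGraph.{u} Δ) (x : G.graph.neighborSet G.root) : BirootedGraph.{u} Δ where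
  toRootedGraph := G
  root₂ := x
  adj := x.2

/-- The birooted graph `(G, x, o)` for a neighbour `x` of the root `o`. -/
def inEdge (G : RootedGraph.{u} Δ) (x : G.graph.neighborSet G.root) : BirootedGraph.{u} Δ where
  toRootedGraph := { G with root := x }
  root₂ := G.root
  adj := x.2.symm

/-- A rooted isomorphism induces a bijection between the neighbours of the roots. -/
def neighborEquiv {G H : RootedGraph.{u} Δ} (e : G.graph ≃g H.graph) (he : e G.root = H.root) :
    G.graph.neighborSet G.root ≃ H.graph.neighborSet H.root :=
  e.toEquiv.subtypeEquiv (fun a => by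
    change G.graph.Adj G.root a ↔ H.graph.Adj H.root (e a)
    rw [← he, e.map_adj_iff])

end RootedGraph

namespace Gr

variable {Δ : ℕ}

/-- The function `[G, o] ↦ ∑_{x ∈ N_G(o)} f[G, o, x]`. -/
def outSum (f : BiGr.{u} Δ → ℝ≥0∞) : Gr.{u} Δ → ℝ≥0∞ :=
  Quotient.lift (fun G : RootedGraph.{u} Δ =>
      ∑' x : G.graph.neighborSet G.root, f (G.outEdge x).toBiGr) (by
    rintro G H ⟨e, he⟩
    refine Eq.trans ?_ ((RootedGraph.neighborEquiv e he).tsum_eq _)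
    refine tsum_congr fun x => congrArg f ?_
    exact Quotient.sound ⟨e, he, rfl⟩)

/-- The function `[G, o] ↦ ∑_{x ∈ N_G(o)} f[G, x, o]`. -/
def inSum (f : BiGr.{u} Δ → ℝ≥0∞) : Gr.{u} Δ → ℝ≥0∞ :=
  Quotient.lift (fun G : RootedGraph.{u} Δ =>
      ∑' x : G.graph.neighborSet G.root, f (G.inEdge x).toBiGr) (by
    rintro G H ⟨e, he⟩
    refine Eq.trans ?_ ((RootedGraph.neighborEquiv e he).tsum_eq _)
    refine tsum_congr fun x => congrArg f ?_
    exact Quotient.sound ⟨e, rfl, he⟩)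

/-- A measure on `𝐆𝐫` is unimodular if for all nonnegative real-valued Borel functions `f` on
birooted classes, the integrals of `∑_{x ∈ N_G(o)} f[G, x, o]` and of `∑_{x ∈ N_G(o)} f[G, o, x]`
agree, as elements of `[0, ∞]`. -/
def IsUnimodular (ν : Measure (Gr.{u} Δ)) : Prop :=
  ∀ f : BiGr.{u} Δ → ℝ≥0, Measurable f →
    ∫⁻ a, inSum (fun e => (f e : ℝ≥0∞)) a ∂ν = ∫⁻ a, outSum (fun e => (f e : ℝ≥0∞)) a ∂ν

end Gr

/-! ## Measurable graphings and their laws -/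

/-- A measurable graphing `(X, i₁, …, i_k, μ)`: finitely many measure-preserving Borel involutions
of a probability space. -/
structure MeasurableGraphing (X : Type u) [MeasurableSpace X] where
  k : ℕ
  inv : Fin k → X → X
  μ : Measure X
  isProbabilityMeasure : IsProbabilityMeasure μ
  involutive : ∀ j, Function.Involutive (inv j)
  measurePreserving : ∀ j, MeasurePreserving (inv j) μ μ

namespace MeasurableGraphing

variable {X : Type u} [MeasurableSpace X]

/-- The leafgraph: distinct points `x`, `y` are adjacent when `y = i_j x` for some `j`. -/
def leafgraph (𝒢 : MeasurableGraphing X) : SimpleGraph X where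
  Adj x y := x ≠ y ∧ ∃ j, y = 𝒢.inv j x
  symm := ⟨by
    rintro x y ⟨hne, j, rfl⟩
    exact ⟨hne.symm, j, (𝒢.involutive j x).symm⟩⟩
  loopless := ⟨fun _ h => h.1 rfl⟩

/-- All vertices of the leafgraph have degree at most `Δ` (automatic when `k ≤ Δ`). -/
def DegreeLE (𝒢 : MeasurableGraphing X) (Δ : ℕ) : Prop :=
  ∀ x, (𝒢.leafgraph.neighborSet x).encard ≤ (Δ : ℕ∞)

theorem countable_component (𝒢 : MeasurableGraphing X) (x : X) :
    Countable (𝒢.leafgraph.connectedComponentMk x) := by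
  have hsub : ((𝒢.leafgraph.connectedComponentMk x).supp : Set X) ⊆
      Set.range (fun l : List (Fin 𝒢.k) => l.foldr 𝒢.inv x) := by
    intro y hy
    obtain ⟨p⟩ : 𝒢.leafgraph.Reachable y x := SimpleGraph.ConnectedComponent.exact hy
    clear hy
    induction p with
    | nil => exact ⟨[], rfl⟩
    | cons h p ih =>
      obtain ⟨l, hl⟩ := ih
      obtain ⟨-, j, hj⟩ := h.symm
      exact ⟨j :: l, by rw [hj, ← hl]; rfl⟩
  exact ((Set.countable_range _).mono hsub).to_subtype

/-- The rooted graph `(ℒ_x, x)`, where `ℒ_x` is the connected component of `x` in the leafgraph. -/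
def rootedComponent (𝒢 : MeasurableGraphing X) {Δ : ℕ} (hΔ : 𝒢.DegreeLE Δ) (x : X) :
    RootedGraph.{u} Δ where
  V := 𝒢.leafgraph.connectedComponentMk x
  graph := (𝒢.leafgraph.connectedComponentMk x).toSimpleGraph
  root := ⟨x, rfl⟩
  countable := 𝒢.countable_component x
  connected := (𝒢.leafgraph.connectedComponentMk x).connected_toSimpleGraph
  degree_le := by
    intro v
    refine le_trans ?_ (hΔ v.1)
    rw [← Function.Injective.encard_image Subtype.val_injective]
    refine Set.encard_le_encard ?_
    rintro _ ⟨w, hw, rfl⟩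
    exact hw

/-- The map `x ↦ [ℒ_x, x]` from `X` to `𝐆𝐫`. -/
def componentMap (𝒢 : MeasurableGraphing X) {Δ : ℕ} (hΔ : 𝒢.DegreeLE Δ) (x : X) : Gr.{u} Δ :=
  (𝒢.rootedComponent hΔ x).toGr

/-- The law `Ψ(𝒢)`: the push-forward of `μ` under `x ↦ [ℒ_x, x]`. -/
def law (𝒢 : MeasurableGraphing X) {Δ : ℕ} (hΔ : 𝒢.DegreeLE Δ) : Measure (Gr.{u} Δ) :=
  𝒢.μ.map (𝒢.componentMap hΔ)

end MeasurableGraphing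

end

/-! Measurability: every vertex of `ℒ_x` is a word in the involutions applied to `x`, and the ball
of radius `s` around `x` is determined up to isomorphism by which words of length at most `s + 1`
agree at `x` (`SamePattern.exists_ball_iso`). These are finitely many conditions, each measurable
because `X` is countably separated, so `measurable_of_finite_patterns` applies; the same holds for
the edge classes `[ℒ_x, x, i_j x]`.

Unimodularity: label each edge at `x` by the least `j` with `i_j` mapping `x` to the other end.
Since `i_j` is an involution, both ends choose the same label, so `i_j` exchanges the ends of all
edges labelled `j`. Hence the outgoing sum at `x` is a sum over `j` of functions of `x`, and the
incoming sum is the sum of the same functions at `i_j x`. Their integrals agree label by label, as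
`i_j` preserves `μ`. Transferring the integrals from `𝐆𝐫` to `X` requires both sums to be Borel on
`𝐆𝐫` (`Gr.measurable_of_eq_tsum`). -/

/-! ## Isomorphisms of balls -/

namespace SimpleGraph

variable {V : Type*} {W : Type*} {G : SimpleGraph V} {H : SimpleGraph W}

theorem Connected.exists_adj_dist_le (hG : G.Connected) {c v : V} {n : ℕ}
    (h : G.dist c v = n + 1) : ∃ u, G.Adj v u ∧ G.dist c u ≤ n := by
  obtain ⟨p, hp⟩ := hG.exists_walk_length_eq_dist v c
  rw [dist_comm, h] at hp
  cases p with
  | nil => simp at hp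
  | cons hadj q =>
    refine ⟨_, hadj, ?_⟩
    rw [dist_comm]
    exact (dist_le q).trans (by simpa using hp.le)

theorem Connected.dist_le_succ (hG : G.Connected) {c u v : V} {n : ℕ} (h : G.dist c u ≤ n)
    (hadj : G.Adj u v) : G.dist c v ≤ n + 1 :=
  hG.dist_triangle.trans (Nat.add_le_add h (dist_eq_one_iff_adj.2 hadj).le)

/-- A homomorphism between induced subgraphs does not increase distances up to the radius of a ball
contained in the domain. -/
theorem dist_le_of_induce_hom (hG : G.Connected) (hH : H.Connected) {A : Set V} {B : Set W}
    (f : G.induce A →g H.induce B) {c : V} (hc : c ∈ A) {s : ℕ}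
    (hA : ∀ v, G.dist c v ≤ s → v ∈ A) {n : ℕ} (hn : n ≤ s) {v : V} (hv : v ∈ A)
    (h : G.dist c v ≤ n) : H.dist (f ⟨c, hc⟩) (f ⟨v, hv⟩) ≤ n := by
  induction n generalizing v with
  | zero =>
    obtain rfl : c = v := (hG.dist_eq_zero_iff).1 (Nat.le_zero.1 h)
    simp
  | succ n ih =>
    rcases Nat.lt_or_ge (G.dist c v) (n + 1) with h' | h'
    · exact (ih (by omega) hv (by omega)).trans (Nat.le_succ n)
    -- The vertex `u` before `v` on a geodesic from `c` also lies in `A`, so `f` preserves the edge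
    -- from `u` to `v`.
    · obtain ⟨u, hu, hd⟩ := hG.exists_adj_dist_le (le_antisymm h h')
      have huA : u ∈ A := hA u (by omega)
      refine hH.dist_le_succ (ih (by omega) huA hd) ?_
      have : (G.induce A).Adj ⟨u, huA⟩ ⟨v, hv⟩ := hu.symm
      exact f.map_adj this

/-- An isomorphism between induced subgraphs restricts to balls contained in them. -/
def Iso.restrictBall (hG : G.Connected) (hH : H.Connected) {A : Set V} {B : Set W}
    (e : G.induce A ≃g H.induce B) {c : V} {c' : W} (hc : c ∈ A) (hc' : c' ∈ B)
    (hcc : e ⟨c, hc⟩ = ⟨c', hc'⟩) {s : ℕ}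
    (hA : ∀ v, G.dist c v ≤ s → v ∈ A) (hB : ∀ w, H.dist c' w ≤ s → w ∈ B) :
    G.induce {v | G.dist c v ≤ s} ≃g H.induce {w | H.dist c' w ≤ s} where
  toFun v := ⟨e ⟨v, hA v v.2⟩, by
    have := dist_le_of_induce_hom hG hH e.toHom hc hA le_rfl (hA v v.2) v.2
    change H.dist (e ⟨c, hc⟩) _ ≤ s at this
    rwa [hcc] at this⟩
  invFun w := ⟨e.symm ⟨w, hB w w.2⟩, by
    have := dist_le_of_induce_hom hH hG e.symm.toHom hc' hB le_rfl (hB w w.2) w.2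
    change G.dist (e.symm ⟨c', hc'⟩) _ ≤ s at this
    rwa [← hcc, e.symm_apply_apply] at this⟩
  left_inv v := Subtype.ext (by simp)
  right_inv w := Subtype.ext (by simp)
  map_rel_iff' {a b} := e.map_adj_iff (v := ⟨a, hA a a.2⟩) (w := ⟨b, hA b b.2⟩)

end SimpleGraph

namespace RootedGraph

variable {Δ : ℕ}

theorem root_mem_ballSet (G : RootedGraph.{u} Δ) (s : ℕ) : G.root ∈ G.ballSet s := by
  simp [ballSet]

theorem BallIso.refl (s : ℕ) (G : RootedGraph.{u} Δ) : BallIso s G G :=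
  ⟨SimpleGraph.Iso.refl, fun _ => Iff.rfl⟩

theorem ballSet_mono (G : RootedGraph.{u} Δ) {s t : ℕ} (hst : s ≤ t) :
    G.ballSet s ⊆ G.ballSet t := fun _ h => le_trans h hst

theorem neighbor_mem_ballSet (G : RootedGraph.{u} Δ) (s : ℕ)
    (x : G.graph.neighborSet G.root) : (x : G.V) ∈ G.ballSet (s + 1) :=
  (SimpleGraph.dist_eq_one_iff_adj.2 x.2).le.trans (by omega)

theorem mem_ballSet_of_dist_neighbor_le (G : RootedGraph.{u} Δ) {s : ℕ}
    (x : G.graph.neighborSet G.root) (v : G.V) (h : G.graph.dist x v ≤ s) :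
    v ∈ G.ballSet (s + 1) := by
  have h1 := SimpleGraph.dist_eq_one_iff_adj.2 x.2
  have h2 := G.connected.dist_triangle (u := G.root) (v := (x : G.V)) (w := v)
  change G.graph.dist G.root v ≤ s + 1
  omega

theorem BallIso.mono {s t : ℕ} (hst : s ≤ t) {G H : RootedGraph.{u} Δ} (h : BallIso t G H) :
    BallIso s G H := by
  obtain ⟨e, he⟩ := h
  have hr : e ⟨G.root, G.root_mem_ballSet t⟩ = ⟨H.root, H.root_mem_ballSet t⟩ :=
    Subtype.ext ((he _).1 rfl)
  exact ⟨SimpleGraph.Iso.restrictBall G.connected H.connected e _ _ hr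
    (fun v hv => G.ballSet_mono hst hv) (fun v hv => H.ballSet_mono hst hv),
    fun v => he ⟨v, G.ballSet_mono hst v.2⟩⟩

/-- An isomorphism of balls of radius `s + 1` matches the neighbours of the roots, in such a way
that the balls of radius `s` around corresponding edges agree. -/
theorem BallIso.exists_neighbor_map {s : ℕ} {G H : RootedGraph.{u} Δ} (h : BallIso (s + 1) G H) :
    ∃ m : G.graph.neighborSet G.root → H.graph.neighborSet H.root, Function.Injective m ∧
      ∀ x, BirootedGraph.BallIso s (G.outEdge x) (H.outEdge (m x)) ∧
        BirootedGraph.BallIso s (G.inEdge x) (H.inEdge (m x)) := by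
  obtain ⟨e, he⟩ := h
  have hr : e ⟨G.root, G.root_mem_ballSet _⟩ = ⟨H.root, H.root_mem_ballSet _⟩ :=
    Subtype.ext ((he _).1 rfl)
  have key : ∀ (x : G.V) (hx : x ∈ G.ballSet (s + 1)) (y : H.V), (e ⟨x, hx⟩ : H.V) = y →
      ∀ v : G.ballSet (s + 1), (v : G.V) = x ↔ (e v : H.V) = y := by
    rintro x hx y rfl v
    rw [← Subtype.ext_iff, e.injective.eq_iff, Subtype.ext_iff]
  let m : G.graph.neighborSet G.root → H.graph.neighborSet H.root := fun x =>
    ⟨e ⟨x, G.neighbor_mem_ballSet s x⟩, by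
      have h1 : (G.graph.induce (G.ballSet (s + 1))).Adj ⟨G.root, G.root_mem_ballSet _⟩
        ⟨x, G.neighbor_mem_ballSet s x⟩ := x.2
      have h2 := e.map_adj_iff.2 h1
      rw [hr] at h2
      exact h2⟩
  refine ⟨m, ?_, fun x => ⟨?_, ?_⟩⟩
  · intro x y hxy
    have h1 := e.injective (Subtype.ext
      (congrArg (fun z : H.graph.neighborSet H.root => (z : H.V)) hxy))
    exact Subtype.ext (Subtype.mk.inj h1)
  · exact ⟨SimpleGraph.Iso.restrictBall G.connected H.connected e _ _ hr
      (fun v hv => G.ballSet_mono (Nat.le_succ s) hv)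
      (fun v hv => H.ballSet_mono (Nat.le_succ s) hv),
      fun v => he ⟨v.1, G.ballSet_mono (Nat.le_succ s) v.2⟩,
      fun v => key x (G.neighbor_mem_ballSet s x) _ rfl ⟨v.1, G.ballSet_mono (Nat.le_succ s) v.2⟩⟩
  -- The ball of radius `s` around a neighbour lies in the ball of radius `s + 1` around the root,
  -- so the same `e` restricts to it with the neighbour as centre.
  · exact ⟨SimpleGraph.Iso.restrictBall G.connected H.connected e
      (G.neighbor_mem_ballSet s x) (H.neighbor_mem_ballSet s (m x)) rfl
      (fun v hv => G.mem_ballSet_of_dist_neighbor_le x v hv)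
      (fun v hv => H.mem_ballSet_of_dist_neighbor_le (m x) v hv),
      fun v => key x (G.neighbor_mem_ballSet s x) _ rfl
        ⟨v.1, G.mem_ballSet_of_dist_neighbor_le x v.1 v.2⟩,
      fun v => he ⟨v.1, G.mem_ballSet_of_dist_neighbor_le x v.1 v.2⟩⟩

end RootedGraph

/-! ## Open sets of rooted and birooted classes -/

namespace Gr

variable {Δ : ℕ}

theorem sameBall_refl (s : ℕ) (a : Gr.{u} Δ) : SameBall s a a := by
  induction a using Quotient.inductionOn
  exact RootedGraph.BallIso.refl s _

theorem SameBall.mono {s t : ℕ} (hst : s ≤ t) {a b : Gr.{u} Δ} (h : SameBall t a b) :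
    SameBall s a b := by
  induction a using Quotient.inductionOn
  induction b using Quotient.inductionOn
  exact RootedGraph.BallIso.mono hst h

theorem SameBall.trans {s : ℕ} {a b c : Gr.{u} Δ} (h : SameBall s a b) (h' : SameBall s b c) :
    SameBall s a c := by
  induction a using Quotient.inductionOn
  induction b using Quotient.inductionOn
  induction c using Quotient.inductionOn
  exact RootedGraph.BallIso.trans h h'

theorem rho_le {s : ℕ} {a b : Gr.{u} Δ} (h : SameBall s a b) : rho a b ≤ (2 : ℝ)⁻¹ ^ s := by
  unfold rho
  split_ifs
  · positivity
  · exact ciInf_le (f := fun t : {s : ℕ // SameBall s a b} => ((2 : ℝ)⁻¹) ^ (t : ℕ))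
      ⟨0, by rintro _ ⟨t, rfl⟩; positivity⟩ ⟨s, h⟩

/-- Ensures that the infimum in `rho` has a nonempty index type; over an empty one it would take the
default value `0`. -/
theorem sameBall_zero (a b : Gr.{u} Δ) : SameBall 0 a b := by
  induction a using Quotient.inductionOn with | _ G
  induction b using Quotient.inductionOn with | _ H
  have key : ∀ (K : RootedGraph.{u} Δ) (v : K.ballSet 0), v = ⟨K.root, K.root_mem_ballSet 0⟩ :=
    fun K v => Subtype.ext (K.connected.dist_eq_zero_iff.1 (Nat.le_zero.1 v.2)).symm
  refine ⟨⟨⟨fun _ => ⟨H.root, H.root_mem_ballSet 0⟩, fun _ => ⟨G.root, G.root_mem_ballSet 0⟩,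
    fun v => (key G v).symm, fun v => (key H v).symm⟩, ?_⟩, fun v => ?_⟩
  · intro v w
    rw [key G v, key G w]
    simp
  · rw [key G v]
    simp

theorem sameBall_of_rho_lt {s : ℕ} {a b : Gr.{u} Δ} (h : rho a b < (2 : ℝ)⁻¹ ^ s) :
    SameBall s a b := by
  unfold rho at h
  split_ifs at h with hab
  · exact hab ▸ sameBall_refl s a
  · have : Nonempty {s : ℕ // SameBall s a b} := ⟨⟨0, sameBall_zero a b⟩⟩
    obtain ⟨⟨t, ht⟩, hlt⟩ := exists_lt_of_ciInf_lt h
    refine ht.mono (le_of_lt ?_)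
    exact (pow_lt_pow_iff_right_of_lt_one₀ (by norm_num) (by norm_num)).1 hlt

/-- A set is open exactly when it contains, with each class, all classes with the same ball of a
suitable radius. -/
theorem isOpen_iff {U : Set (Gr.{u} Δ)} :
    IsOpen U ↔ ∀ a ∈ U, ∃ s, ∀ b, SameBall s a b → b ∈ U := by
  constructor
  · intro hU a ha
    obtain ⟨ε, hε, h⟩ := hU a ha
    obtain ⟨s, hs⟩ := exists_pow_lt_of_lt_one hε (by norm_num : (2 : ℝ)⁻¹ < 1)
    exact ⟨s, fun b hb => h b ((rho_le hb).trans_lt hs)⟩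
  · intro h a ha
    obtain ⟨s, hs⟩ := h a ha
    exact ⟨(2 : ℝ)⁻¹ ^ s, by positivity, fun b hb => hs b (sameBall_of_rho_lt hb)⟩

end Gr

namespace BiGr

variable {Δ : ℕ}

theorem sameBall_refl (s : ℕ) (a : BiGr.{u} Δ) : SameBall s a a := by
  induction a using Quotient.inductionOn
  exact ⟨SimpleGraph.Iso.refl, fun _ => Iff.rfl, fun _ => Iff.rfl⟩

theorem SameBall.trans {s : ℕ} {a b c : BiGr.{u} Δ} (h : SameBall s a b) (h' : SameBall s b c) :
    SameBall s a c := by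
  induction a using Quotient.inductionOn
  induction b using Quotient.inductionOn
  induction c using Quotient.inductionOn
  exact BirootedGraph.BallIso.trans h h'

theorem SameBall.mono {s t : ℕ} (hst : s ≤ t) {a b : BiGr.{u} Δ} (h : SameBall t a b) :
    SameBall s a b := by
  induction a using Quotient.inductionOn with | _ G
  induction b using Quotient.inductionOn with | _ H
  obtain ⟨e, he, he'⟩ := h
  have hr : e ⟨G.root, G.root_mem_ballSet t⟩ = ⟨H.root, H.root_mem_ballSet t⟩ :=
    Subtype.ext ((he _).1 rfl)
  exact ⟨SimpleGraph.Iso.restrictBall G.connected H.connected e _ _ hr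
    (fun v hv => G.ballSet_mono hst hv) (fun v hv => H.ballSet_mono hst hv),
    fun v => he ⟨v, G.ballSet_mono hst v.2⟩, fun v => he' ⟨v, G.ballSet_mono hst v.2⟩⟩

theorem rho_le {s : ℕ} {a b : BiGr.{u} Δ} (h : SameBall s a b) : rho a b ≤ (2 : ℝ)⁻¹ ^ s := by
  unfold rho
  split_ifs
  · positivity
  · exact ciInf_le (f := fun t : {s : ℕ // SameBall s a b} => ((2 : ℝ)⁻¹) ^ (t : ℕ))
      ⟨0, by rintro _ ⟨t, rfl⟩; positivity⟩ ⟨s, h⟩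

/-- Only this half of the analogue of `Gr.isOpen_iff` is needed: no set of birooted classes has to
be proved open. -/
theorem exists_sameBall_subset {U : Set (BiGr.{u} Δ)} (hU : IsOpen U) {a : BiGr.{u} Δ}
    (ha : a ∈ U) : ∃ s, ∀ b, SameBall s a b → b ∈ U := by
  obtain ⟨ε, hε, h⟩ := hU a ha
  obtain ⟨s, hs⟩ := exists_pow_lt_of_lt_one hε (by norm_num : (2 : ℝ)⁻¹ < 1)
  exact ⟨s, fun b hb => h b ((rho_le hb).trans_lt hs)⟩

end BiGr

/-! ## Measurability of sums over the neighbours of the root -/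

namespace RootedGraph

variable {Δ : ℕ}

theorem finite_neighborSet_root (G : RootedGraph.{u} Δ) :
    Finite (G.graph.neighborSet G.root) :=
  Set.finite_of_encard_le_coe (G.degree_le G.root)

end RootedGraph

namespace Gr

variable {Δ : ℕ}

/-- Summing a Borel function over edges at the root gives a Borel function on rooted classes, if
the ball of radius `s + 1` determines the birooted balls of radius `s` of these edges. -/
theorem measurable_of_eq_tsum
    (E : ∀ G : RootedGraph.{u} Δ, G.graph.neighborSet G.root → BiGr.{u} Δ)
    (hE : ∀ (s : ℕ) (G H : RootedGraph.{u} Δ), RootedGraph.BallIso (s + 1) G H →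
      ∃ m : G.graph.neighborSet G.root → H.graph.neighborSet H.root, Function.Injective m ∧
        ∀ x, BiGr.SameBall s (E G x) (E H (m x)))
    (F : (BiGr.{u} Δ → ℝ≥0∞) → Gr.{u} Δ → ℝ≥0∞)
    (hF : ∀ f (G : RootedGraph.{u} Δ), F f G.toGr = ∑' x, f (E G x))
    {f : BiGr.{u} Δ → ℝ≥0∞} (hf : Measurable f) : Measurable (F f) := by
  -- With `κ a` the counting measure of the edges at the root, `F g a` is the integral of `g`
  -- against `κ a`. So it suffices that `κ` is a measurable family, which for finite measures can be
  -- tested on the π-system of open sets.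
  let κ : Gr.{u} Δ → Measure (BiGr.{u} Δ) := fun a =>
    Measure.sum fun x => Measure.dirac (E (Quotient.out a) x)
  have hκ : ∀ {g : BiGr.{u} Δ → ℝ≥0∞}, Measurable g → ∀ a, F g a = ∫⁻ e, g e ∂κ a := by
    intro g hg a
    have h1 : (Quotient.out a).toGr = a := Quotient.out_eq a
    conv_lhs => rw [← h1, hF]
    simp only [κ, lintegral_sum_measure, lintegral_dirac' _ hg]
  have hfin : ∀ a, IsFiniteMeasure (κ a) := by
    intro a
    have := (Quotient.out a).finite_neighborSet_root
    have := Fintype.ofFinite ((Quotient.out a).graph.neighborSet (Quotient.out a).root)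
    simp only [κ, Measure.sum_fintype]
    infer_instance
  have hopen : ∀ U : Set (BiGr.{u} Δ), IsOpen U → Measurable fun a => κ a U := by
    intro U hU
    have hind : (fun a => κ a U) = F (U.indicator 1) := by
      funext a
      rw [hκ (measurable_one.indicator hU.measurableSet), lintegral_indicator_one hU.measurableSet]
    rw [hind]
    -- The number of root edges with class in `U` is lower semicontinuous: finitely many edges lie
    -- in `U`, each because of a ball of finite radius. A class with the same ball of a larger
    -- radius contains injectively matched edges, again in `U`.
    refine LowerSemicontinuous.measurable (lowerSemicontinuous_iff_isOpen_preimage.2 fun t => ?_)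
    rw [Gr.isOpen_iff]
    intro a ha
    induction a using Quotient.inductionOn with | _ G
    have := G.finite_neighborSet_root
    have hr : ∀ x : G.graph.neighborSet G.root, ∃ s, E G x ∈ U →
        ∀ b, BiGr.SameBall s (E G x) b → b ∈ U := by
      intro x
      by_cases hx : E G x ∈ U
      · obtain ⟨s, hs⟩ := BiGr.exists_sameBall_subset hU hx
        exact ⟨s, fun _ => hs⟩
      · exact ⟨0, fun h => absurd h hx⟩
    choose r hr using hr
    obtain ⟨s, hs⟩ := (Set.finite_range r).bddAbove
    refine ⟨s + 1, fun b hb => ?_⟩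
    induction b using Quotient.inductionOn with | _ H
    obtain ⟨m, hm, hmE⟩ := hE s G H hb
    refine lt_of_lt_of_le (show t < F _ ⟦G⟧ from ha) ?_
    change F _ G.toGr ≤ F _ H.toGr
    rw [hF, hF]
    refine le_trans (ENNReal.tsum_le_tsum fun x => ?_)
      (ENNReal.tsum_comp_le_tsum_of_injective hm fun y => U.indicator 1 (E H y))
    by_cases hx : E G x ∈ U
    · have hy : E H (m x) ∈ U := hr x hx _ ((hmE x).mono (hs ⟨x, rfl⟩))
      simp [hx, hy]
    · simp [hx]
  have hmeas : Measurable κ := Measurable.measure_of_isPiSystem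
    (S := {U : Set (BiGr.{u} Δ) | IsOpen U}) rfl isPiSystem_isOpen hopen (hopen _ isOpen_univ)
  rw [funext (hκ hf)]
  exact (Measure.measurable_lintegral hf).comp hmeas

theorem measurable_outSum {f : BiGr.{u} Δ → ℝ≥0∞} (hf : Measurable f) : Measurable (outSum f) :=
  measurable_of_eq_tsum (fun G x => (G.outEdge x).toBiGr)
    (fun _ _ _ h => let ⟨m, hm, h'⟩ := h.exists_neighbor_map; ⟨m, hm, fun x => (h' x).1⟩)
    outSum (fun _ _ => rfl) hf

theorem measurable_inSum {f : BiGr.{u} Δ → ℝ≥0∞} (hf : Measurable f) : Measurable (inSum f) :=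
  measurable_of_eq_tsum (fun G x => (G.inEdge x).toBiGr)
    (fun _ _ _ h => let ⟨m, hm, h'⟩ := h.exists_neighbor_map; ⟨m, hm, fun x => (h' x).2⟩)
    inSum (fun _ _ => rfl) hf

end Gr

/-! ## Measurability of the component map and of the edge maps -/

/-- A map is Borel if finitely many measurable conditions determine its value up to any given
precision. -/
theorem measurable_of_finite_patterns {Y Z : Type*} [MeasurableSpace Y] [TopologicalSpace Z]
    [MeasurableSpace Z] [BorelSpace Z] {ι : ℕ → Type*} [∀ s, Finite (ι s)]
    (P : ∀ s, Y → ι s → Prop) (hP : ∀ s i, MeasurableSet {y | P s y i})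
    (R : ℕ → Z → Z → Prop) (hrefl : ∀ s a, R s a a)
    (htrans : ∀ s a b c, R s a b → R s b c → R s a c)
    (hopen : ∀ U : Set Z, IsOpen U → ∀ a ∈ U, ∃ s, ∀ b, R s a b → b ∈ U) (φ : Y → Z)
    (hφ : ∀ s x y, (∀ i, P s x i ↔ P s y i) → R s (φ x) (φ y)) : Measurable φ := by
  refine measurable_of_isOpen fun U hU => ?_
  have hU' : φ ⁻¹' U = ⋃ s, {y | ∀ b, R s (φ y) b → b ∈ U} := by
    ext y
    simp only [Set.mem_preimage, Set.mem_iUnion, Set.mem_ofPred_eq]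
    exact ⟨hopen U hU _, fun ⟨s, hs⟩ => hs _ (hrefl s _)⟩
  rw [hU']
  refine MeasurableSet.iUnion fun s => ?_
  -- This set is a union of fibres of `P s`, whose codomain `ι s → Prop` is finite. Hence it is
  -- measurable without any separability of `Z`.
  have hsat : {y | ∀ b, R s (φ y) b → b ∈ U} =
      P s ⁻¹' (P s '' {y | ∀ b, R s (φ y) b → b ∈ U}) := by
    refine Set.Subset.antisymm (Set.subset_preimage_image _ _) ?_
    rintro y ⟨x, hx, hxy⟩ b hb
    exact hx b (htrans s _ _ _ (hφ s x y fun i => iff_of_eq (congrFun hxy i)) hb)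
  rw [hsat]
  have hmeas : Measurable (P s) := measurable_pi_iff.2 fun i => measurable_to_prop (by
    simpa [Set.preimage] using hP s i)
  exact hmeas (Set.toFinite _).measurableSet

/-- A countable separating family yields a measurable injection into `ℕ → Bool`, where equality of
measurable maps is a measurable condition. -/
theorem MeasurableSpace.CountablySeparated.measurableSet_eq_fun {X Y : Type*} [MeasurableSpace X]
    [MeasurableSpace Y] [MeasurableSpace.CountablySeparated X] {f g : Y → X} (hf : Measurable f)
    (hg : Measurable g) : MeasurableSet {y | f y = g y} := by
  obtain ⟨h, hm, hinj⟩ := MeasurableSpace.measurable_injection_nat_bool_of_countablySeparated X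
  have := _root_.measurableSet_eq_fun (hm.comp hf) (hm.comp hg)
  simpa only [Function.comp_apply, hinj.eq_iff] using this

/-! ### Words in the involutions and balls of the leafgraph -/

namespace MeasurableGraphing

variable {X : Type u} [MeasurableSpace X] (𝒢 : MeasurableGraphing X) {Δ : ℕ}

/-- The action of a word in the involutions. -/
def word (l : List (Fin 𝒢.k)) (x : X) : X := l.foldr 𝒢.inv x

theorem measurable_word (l : List (Fin 𝒢.k)) : Measurable (𝒢.word l) := by
  induction l with
  | nil => exact measurable_id
  | cons j l ih => exact (𝒢.measurePreserving j).measurable.comp ih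

theorem reachable_inv (j : Fin 𝒢.k) (x : X) : 𝒢.leafgraph.Reachable (𝒢.inv j x) x := by
  by_cases h : x = 𝒢.inv j x
  · rw [← h]
  · exact (show 𝒢.leafgraph.Adj x (𝒢.inv j x) from ⟨h, j, rfl⟩).symm.reachable

theorem word_mem_component (l : List (Fin 𝒢.k)) (x : X) :
    𝒢.word l x ∈ 𝒢.leafgraph.connectedComponentMk x := by
  refine SimpleGraph.ConnectedComponent.sound ?_
  induction l with
  | nil => exact SimpleGraph.Reachable.refl x
  | cons j l ih => exact (𝒢.reachable_inv j _).trans ih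

theorem vertex_ext_iff (hΔ : 𝒢.DegreeLE Δ) {x : X} {v w : (𝒢.rootedComponent hΔ x).V} :
    v = w ↔ (v.1 : X) = w.1 := Subtype.ext_iff

/-- Each step of a geodesic applies some `i_j`; conversely each letter of a word either fixes the
current point or follows an edge. -/
theorem mem_ballSet_iff (hΔ : 𝒢.DegreeLE Δ) {s : ℕ} {x : X}
    (v : 𝒢.leafgraph.connectedComponentMk x) :
    v ∈ (𝒢.rootedComponent hΔ x).ballSet s ↔ ∃ l, l.length ≤ s ∧ 𝒢.word l x = v := by
  have hconn := (𝒢.rootedComponent hΔ x).connected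
  constructor
  · intro h
    induction s generalizing v with
    | zero =>
      refine ⟨[], le_rfl, ?_⟩
      exact congrArg Subtype.val (hconn.dist_eq_zero_iff.1 (Nat.le_zero.1 h))
    | succ s ih =>
      rcases Nat.lt_or_ge ((𝒢.rootedComponent hΔ x).graph.dist
        (𝒢.rootedComponent hΔ x).root v) (s + 1) with h' | h'
      · obtain ⟨l, hl, hv⟩ := ih v (Nat.lt_succ_iff.1 h')
        exact ⟨l, by omega, hv⟩
      · obtain ⟨u, hu, hd⟩ := hconn.exists_adj_dist_le (le_antisymm h h')
        obtain ⟨l, hl, hv⟩ := ih u hd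
        obtain ⟨-, j, hj⟩ : 𝒢.leafgraph.Adj u.1 v.1 := hu.symm
        exact ⟨j :: l, by simpa using hl, by rw [hj, ← hv]; rfl⟩
  · rintro ⟨l, hl, hv⟩
    induction l generalizing s v with
    | nil =>
      obtain rfl : (𝒢.rootedComponent hΔ x).root = v := Subtype.ext hv
      exact RootedGraph.root_mem_ballSet _ s
    | cons j l ih =>
      obtain ⟨s, rfl⟩ : ∃ t, s = t + 1 := ⟨s - 1, by simp at hl; omega⟩
      have hw := ih (s := s) ⟨𝒢.word l x, 𝒢.word_mem_component l x⟩ (by simpa using hl) rfl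
      by_cases heq : 𝒢.word l x = v
      · have : (⟨𝒢.word l x, 𝒢.word_mem_component l x⟩ :
            𝒢.leafgraph.connectedComponentMk x) = v := Subtype.ext heq
        rw [← this]
        exact RootedGraph.ballSet_mono _ (Nat.le_succ s) hw
      · refine hconn.dist_le_succ hw ?_
        have : 𝒢.leafgraph.Adj (𝒢.word l x) v := ⟨heq, j, hv.symm⟩
        exact this

/-- The same words of length at most `n` agree at `x` and at `y`. -/
def SamePattern (n : ℕ) (x y : X) : Prop :=
  ∀ l l' : List (Fin 𝒢.k), l.length ≤ n → l'.length ≤ n →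
    (𝒢.word l x = 𝒢.word l' x ↔ 𝒢.word l y = 𝒢.word l' y)

/-- The isomorphism sends `𝒢.word l x` to `𝒢.word l y`. The last clause serves to locate the roots:
`l = []` gives the first and `l = [j]` the second, the latter being admissible even for `s = 0`. -/
theorem SamePattern.exists_ball_iso {𝒢 : MeasurableGraphing X} (hΔ : 𝒢.DegreeLE Δ) {s : ℕ}
    {x y : X} (h : 𝒢.SamePattern (s + 1) x y) :
    ∃ e : (𝒢.rootedComponent hΔ x).graph.induce ((𝒢.rootedComponent hΔ x).ballSet s) ≃g
        (𝒢.rootedComponent hΔ y).graph.induce ((𝒢.rootedComponent hΔ y).ballSet s),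
      ∀ l, l.length ≤ s + 1 →
        ∀ v, (v.1.1 : X) = 𝒢.word l x ↔ ((e v).1.1 : X) = 𝒢.word l y := by
  have hw : ∀ (z : X) (v : (𝒢.rootedComponent hΔ z).ballSet s), ∃ l, l.length ≤ s ∧
      𝒢.word l z = v.1.1 := fun z v => (𝒢.mem_ballSet_iff hΔ v.1).1 v.2
  choose w hws hwv using hw
  let t : ∀ z z' : X, (𝒢.rootedComponent hΔ z).ballSet s → (𝒢.rootedComponent hΔ z').ballSet s :=
    fun z z' v => ⟨⟨𝒢.word (w z v) z', 𝒢.word_mem_component _ _⟩,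
      (𝒢.mem_ballSet_iff hΔ _).2 ⟨w z v, hws z v, rfl⟩⟩
  have ht : ∀ z z', 𝒢.SamePattern (s + 1) z z' → ∀ l, l.length ≤ s + 1 → ∀ v,
      (v.1.1 : X) = 𝒢.word l z ↔ ((t z z' v).1.1 : X) = 𝒢.word l z' := by
    intro z z' hz l hl v
    rw [← hwv z v]
    exact hz _ _ ((hws z v).trans (Nat.le_succ s)) hl
  have hinv : ∀ z z', 𝒢.SamePattern (s + 1) z z' → Function.LeftInverse (t z' z) (t z z') := by
    intro z z' hz v
    have h1 := hz (w z' (t z z' v)) (w z v) ((hws _ _).trans (Nat.le_succ s))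
      ((hws _ _).trans (Nat.le_succ s))
    have h2 := h1.2 (hwv z' (t z z' v))
    exact Subtype.ext (Subtype.ext (h2.trans (hwv z v)))
  have h' : 𝒢.SamePattern (s + 1) y x := fun l l' hl hl' => (h l l' hl hl').symm
  refine ⟨⟨⟨t x y, t y x, hinv x y h, hinv y x h'⟩, ?_⟩, ht x y h⟩
  intro v v'
  have hadj : ∀ z (a b : (𝒢.rootedComponent hΔ z).ballSet s),
      ((𝒢.rootedComponent hΔ z).graph.induce ((𝒢.rootedComponent hΔ z).ballSet s)).Adj a b ↔
        ¬ b.1.1 = a.1.1 ∧ ∃ j, (b.1.1 : X) = 𝒢.inv j a.1.1 := by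
    intro z a b
    rw [eq_comm]
    rfl
  change (SimpleGraph.induce _ _).Adj (t x y v) (t x y v') ↔ _
  rw [hadj, hadj]
  have h1 := ht x y h (w x v) ((hws x v).trans (Nat.le_succ s)) v'
  rw [hwv x v] at h1
  refine Iff.symm (and_congr (not_congr h1) (exists_congr fun j => ?_))
  -- Adjacency through `i_j` compares a word of length at most `s` with one that is a letter longer;
  -- hence the radius `s + 1` in the pattern.
  have h2 := ht x y h (j :: w x v) (by simpa using hws x v) v'
  have h3 : 𝒢.word (j :: w x v) x = 𝒢.inv j v.1.1 := by rw [← hwv x v]; rfl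
  rw [h3] at h2
  exact h2

theorem SamePattern.sameBall {𝒢 : MeasurableGraphing X} (hΔ : 𝒢.DegreeLE Δ) {s : ℕ}
    {x y : X} (h : 𝒢.SamePattern (s + 1) x y) :
    Gr.SameBall s (𝒢.componentMap hΔ x) (𝒢.componentMap hΔ y) := by
  obtain ⟨e, he⟩ := h.exists_ball_iso hΔ
  refine ⟨e, fun v => ?_⟩
  exact (𝒢.vertex_ext_iff hΔ).trans ((he [] (Nat.zero_le _) v).trans
      (𝒢.vertex_ext_iff hΔ (w := (𝒢.rootedComponent hΔ y).root)).symm)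

/-- The points moved by `i_j`. -/
def moved (j : Fin 𝒢.k) : Set X := {x | x ≠ 𝒢.inv j x}

/-- The class `[ℒ_x, x, i_j x]`, for a point `x` moved by `i_j`. -/
noncomputable def edgeMap (hΔ : 𝒢.DegreeLE Δ) (j : Fin 𝒢.k) (x : 𝒢.moved j) : BiGr.{u} Δ :=
  ((𝒢.rootedComponent hΔ x).outEdge
    ⟨⟨𝒢.inv j x, 𝒢.word_mem_component [j] x⟩, ⟨x.2, j, rfl⟩⟩).toBiGr

theorem SamePattern.sameBall_edgeMap {𝒢 : MeasurableGraphing X} (hΔ : 𝒢.DegreeLE Δ) {s : ℕ}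
    {j : Fin 𝒢.k} {x y : 𝒢.moved j} (h : 𝒢.SamePattern (s + 1) x y) :
    BiGr.SameBall s (𝒢.edgeMap hΔ j x) (𝒢.edgeMap hΔ j y) := by
  obtain ⟨e, he⟩ := h.exists_ball_iso hΔ
  refine ⟨e, fun v => ?_, fun v => ?_⟩
  · exact (𝒢.vertex_ext_iff hΔ).trans ((he [] (Nat.zero_le _) v).trans
      (𝒢.vertex_ext_iff hΔ (w := (𝒢.rootedComponent hΔ y).root)).symm)
  · exact (𝒢.vertex_ext_iff hΔ).trans ((he [j] (by simp) v).trans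
      (𝒢.vertex_ext_iff hΔ (w := ⟨𝒢.inv j y, 𝒢.word_mem_component [j] y⟩)).symm)

section

variable [MeasurableSpace.CountablySeparated X]

theorem measurableSet_word_eq (l l' : List (Fin 𝒢.k)) :
    MeasurableSet {x | 𝒢.word l x = 𝒢.word l' x} :=
  MeasurableSpace.CountablySeparated.measurableSet_eq_fun (𝒢.measurable_word l)
    (𝒢.measurable_word l')

/-- A Borel-space-valued map on a measurable family of points is measurable if equality patterns of
words determine it up to any given precision. -/
theorem measurable_of_samePattern {Y Z : Type*} [MeasurableSpace Y] [TopologicalSpace Z]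
    [MeasurableSpace Z] [BorelSpace Z] {p : Y → X} (hp : Measurable p)
    (R : ℕ → Z → Z → Prop) (hrefl : ∀ s a, R s a a)
    (htrans : ∀ s a b c, R s a b → R s b c → R s a c)
    (hopen : ∀ U : Set Z, IsOpen U → ∀ a ∈ U, ∃ s, ∀ b, R s a b → b ∈ U) (φ : Y → Z)
    (hφ : ∀ s x y, 𝒢.SamePattern (s + 1) (p x) (p y) → R s (φ x) (φ y)) : Measurable φ := by
  have hfin : ∀ s : ℕ, Finite {l : List (Fin 𝒢.k) // l.length ≤ s + 1} :=
    fun s => (List.finite_length_le _ (s + 1)).to_subtype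
  refine measurable_of_finite_patterns
    (ι := fun s => {l : List (Fin 𝒢.k) // l.length ≤ s + 1} ×
      {l : List (Fin 𝒢.k) // l.length ≤ s + 1})
    (fun s y i => 𝒢.word i.1 (p y) = 𝒢.word i.2 (p y))
    (fun s i => hp (𝒢.measurableSet_word_eq i.1 i.2)) R hrefl htrans hopen φ ?_
  intro s x y h
  exact hφ s x y fun l l' hl hl' => h ⟨⟨l, hl⟩, ⟨l', hl'⟩⟩

theorem measurable_componentMap (hΔ : 𝒢.DegreeLE Δ) : Measurable (𝒢.componentMap hΔ) :=
  𝒢.measurable_of_samePattern measurable_id Gr.SameBall Gr.sameBall_refl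
    (fun _ _ _ _ => Gr.SameBall.trans) (fun _ hU => Gr.isOpen_iff.1 hU) _
    (fun _ _ _ h => h.sameBall hΔ)

theorem measurable_edgeMap (hΔ : 𝒢.DegreeLE Δ) (j : Fin 𝒢.k) : Measurable (𝒢.edgeMap hΔ j) :=
  𝒢.measurable_of_samePattern measurable_subtype_coe BiGr.SameBall BiGr.sameBall_refl
    (fun _ _ _ _ => BiGr.SameBall.trans) (fun _ hU _ => BiGr.exists_sameBall_subset hU) _
    (fun _ _ _ h => h.sameBall_edgeMap hΔ)

theorem measurableSet_moved (j : Fin 𝒢.k) : MeasurableSet (𝒢.moved j) :=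
  (𝒢.measurableSet_word_eq [] [j]).compl

end

/-! ## Unimodularity of the law -/

/-- The points moved by `i_j` for which `j` is the first index with this image; these sets
enumerate the neighbours of each point without repetition. -/
def firstMoved (j : Fin 𝒢.k) : Set X :=
  {x | x ∈ 𝒢.moved j ∧ ∀ i < j, 𝒢.inv i x ≠ 𝒢.inv j x}

theorem inv_mem_moved_iff {j : Fin 𝒢.k} {x : X} : 𝒢.inv j x ∈ 𝒢.moved j ↔ x ∈ 𝒢.moved j := by
  change 𝒢.inv j x ≠ 𝒢.inv j (𝒢.inv j x) ↔ x ≠ 𝒢.inv j x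
  rw [𝒢.involutive j x]
  exact ne_comm

/-- For any `i`, `i_i` maps `i_j x` to `x` exactly when it maps `x` to `i_j x`; so the least index
joining two points does not depend on the direction. -/
theorem inv_mem_firstMoved_iff {j : Fin 𝒢.k} {x : X} :
    𝒢.inv j x ∈ 𝒢.firstMoved j ↔ x ∈ 𝒢.firstMoved j := by
  refine and_congr 𝒢.inv_mem_moved_iff (forall₂_congr fun i _ => not_congr ?_)
  rw [𝒢.involutive j x, (𝒢.involutive i).eq_iff]
  exact eq_comm

/-- The points `x` and `i_j x` have the same component, and `i_j` leads back to `x`. The component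
types are only propositionally equal, so an isomorphism that is the identity on points is used. -/
theorem edgeMap_inv (hΔ : 𝒢.DegreeLE Δ) (j : Fin 𝒢.k) (x : 𝒢.moved j) :
    𝒢.edgeMap hΔ j ⟨𝒢.inv j x, 𝒢.inv_mem_moved_iff.2 x.2⟩ =
      ((𝒢.rootedComponent hΔ x).inEdge
        ⟨⟨𝒢.inv j x, 𝒢.word_mem_component [j] x⟩, ⟨x.2, j, rfl⟩⟩).toBiGr := by
  have hc : 𝒢.leafgraph.connectedComponentMk (𝒢.inv j x) =
      𝒢.leafgraph.connectedComponentMk x := 𝒢.word_mem_component [j] x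
  refine Quotient.sound ⟨⟨Equiv.subtypeEquivRight fun v => ?_, Iff.rfl⟩, rfl, ?_⟩
  · change v ∈ 𝒢.leafgraph.connectedComponentMk (𝒢.inv j x) ↔ _
    rw [hc]
  · exact Subtype.ext (𝒢.involutive j x)

theorem bijective_neighbor (hΔ : 𝒢.DegreeLE Δ) (x : X) :
    Function.Bijective (fun j : {j // x ∈ 𝒢.firstMoved j} =>
      (⟨⟨𝒢.inv j x, 𝒢.word_mem_component [j.1] x⟩, ⟨j.2.1, j, rfl⟩⟩ :
        (𝒢.rootedComponent hΔ x).graph.neighborSet (𝒢.rootedComponent hΔ x).root)) := by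
  constructor
  · intro j j' h
    have h1 : 𝒢.inv j x = 𝒢.inv j' x :=
      congrArg (fun z : (𝒢.rootedComponent hΔ x).graph.neighborSet
        (𝒢.rootedComponent hΔ x).root => (z.1.1 : X)) h
    rcases lt_trichotomy j.1 j'.1 with hlt | heq | hlt
    · exact absurd h1 (j'.2.2 _ hlt)
    · exact Subtype.ext heq
    · exact absurd h1.symm (j.2.2 _ hlt)
  · rintro ⟨v, hv⟩
    obtain ⟨hne, hex⟩ : 𝒢.leafgraph.Adj x v.1 := hv
    obtain ⟨j, hj, hmin⟩ := WellFounded.has_min (wellFounded_lt (α := Fin 𝒢.k))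
      {j | v.1 = 𝒢.inv j x} hex
    have hj' : v.1 = 𝒢.inv j x := hj
    refine ⟨⟨j, ⟨?_, fun i hi h => hmin i (hj'.trans h.symm) hi⟩⟩, ?_⟩
    · exact fun h => hne (h.trans hj'.symm)
    · exact Subtype.ext (Subtype.ext hj'.symm)

open Classical in
/-- The function `x ↦ f[ℒ_x, x, i_j x]` on `firstMoved j`, extended by zero. -/
noncomputable def edgeFun (hΔ : 𝒢.DegreeLE Δ) (f : BiGr.{u} Δ → ℝ≥0∞) (j : Fin 𝒢.k) (x : X) :
    ℝ≥0∞ :=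
  (𝒢.firstMoved j).indicator
    (fun x => if hx : x ∈ 𝒢.moved j then f (𝒢.edgeMap hΔ j ⟨x, hx⟩) else 0) x

theorem edgeFun_of_mem (hΔ : 𝒢.DegreeLE Δ) (f : BiGr.{u} Δ → ℝ≥0∞) {j : Fin 𝒢.k} {x : X}
    (hx : x ∈ 𝒢.firstMoved j) : 𝒢.edgeFun hΔ f j x = f (𝒢.edgeMap hΔ j ⟨x, hx.1⟩) := by
  rw [edgeFun, Set.indicator_of_mem hx, dif_pos hx.1]

theorem edgeFun_of_notMem (hΔ : 𝒢.DegreeLE Δ) (f : BiGr.{u} Δ → ℝ≥0∞) {j : Fin 𝒢.k} {x : X}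
    (hx : x ∉ 𝒢.firstMoved j) : 𝒢.edgeFun hΔ f j x = 0 :=
  Set.indicator_of_notMem hx _

/-- Common to the outgoing and incoming sums: reindex the neighbours by their labels, then extend by
zero to all `j`. -/
theorem tsum_neighborSet_eq (hΔ : 𝒢.DegreeLE Δ) (x : X)
    (g : (𝒢.rootedComponent hΔ x).graph.neighborSet (𝒢.rootedComponent hΔ x).root → ℝ≥0∞)
    (h : Fin 𝒢.k → ℝ≥0∞)
    (hgh : ∀ (j : Fin 𝒢.k) (hj : x ∈ 𝒢.firstMoved j),
      g ⟨⟨𝒢.inv j x, 𝒢.word_mem_component [j] x⟩, ⟨hj.1, j, rfl⟩⟩ = h j)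
    (h0 : ∀ j, x ∉ 𝒢.firstMoved j → h j = 0) : ∑' y, g y = ∑ j, h j := by
  rw [← (Equiv.ofBijective _ (𝒢.bijective_neighbor hΔ x)).tsum_eq,
    ← tsum_fintype (L := .unconditional _)]
  have hind : h = Set.indicator {j | x ∈ 𝒢.firstMoved j} h := by
    refine (Set.indicator_eq_self.2 fun j hj => ?_).symm
    by_contra hx
    exact hj (h0 j hx)
  rw [hind, ← tsum_subtype]
  exact tsum_congr fun j => hgh j.1 j.2

theorem outSum_componentMap (hΔ : 𝒢.DegreeLE Δ) (f : BiGr.{u} Δ → ℝ≥0∞) (x : X) :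
    Gr.outSum f (𝒢.componentMap hΔ x) = ∑ j, 𝒢.edgeFun hΔ f j x :=
  𝒢.tsum_neighborSet_eq hΔ x _ _ (fun _ hj => (𝒢.edgeFun_of_mem hΔ f hj).symm)
    (fun _ hj => 𝒢.edgeFun_of_notMem hΔ f hj)

/-- What `x` receives along the edge labelled `j` is what `i_j x` sends along it:
`inv_mem_firstMoved_iff` matches the supports and `edgeMap_inv` the values. -/
theorem inSum_componentMap (hΔ : 𝒢.DegreeLE Δ) (f : BiGr.{u} Δ → ℝ≥0∞) (x : X) :
    Gr.inSum f (𝒢.componentMap hΔ x) = ∑ j, 𝒢.edgeFun hΔ f j (𝒢.inv j x) := by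
  refine 𝒢.tsum_neighborSet_eq hΔ x _ _ (fun j hj => ?_)
    (fun _ hj => 𝒢.edgeFun_of_notMem hΔ f fun h => hj (𝒢.inv_mem_firstMoved_iff.1 h))
  rw [𝒢.edgeFun_of_mem hΔ f (𝒢.inv_mem_firstMoved_iff.2 hj)]
  exact congrArg f (𝒢.edgeMap_inv hΔ j ⟨x, hj.1⟩).symm

section

variable [MeasurableSpace.CountablySeparated X]

theorem measurableSet_firstMoved (j : Fin 𝒢.k) : MeasurableSet (𝒢.firstMoved j) := by
  have h : 𝒢.firstMoved j =
      𝒢.moved j ∩ ⋂ i, ⋂ _ : i < j, {x | 𝒢.word [i] x = 𝒢.word [j] x}ᶜ := by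
    ext x
    simp only [Set.mem_inter_iff, Set.mem_iInter]
    rfl
  rw [h]
  exact (𝒢.measurableSet_moved j).inter
    (MeasurableSet.iInter fun i => MeasurableSet.iInter fun _ =>
      (𝒢.measurableSet_word_eq [i] [j]).compl)

theorem measurable_edgeFun (hΔ : 𝒢.DegreeLE Δ) {f : BiGr.{u} Δ → ℝ≥0∞} (hf : Measurable f)
    (j : Fin 𝒢.k) : Measurable (𝒢.edgeFun hΔ f j) := by
  classical
  refine Measurable.indicator ?_ (𝒢.measurableSet_firstMoved j)
  exact Measurable.dite (hf.comp (𝒢.measurable_edgeMap hΔ j)) measurable_const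
    (𝒢.measurableSet_moved j)

theorem isUnimodular_law (hΔ : 𝒢.DegreeLE Δ) : Gr.IsUnimodular (𝒢.law hΔ) := by
  intro f hf
  have hf' : Measurable fun e => (f e : ℝ≥0∞) := hf.coe_nnreal_ennreal
  have hφ := 𝒢.measurable_componentMap hΔ
  rw [law, lintegral_map (Gr.measurable_inSum hf') hφ, lintegral_map (Gr.measurable_outSum hf') hφ]
  simp only [inSum_componentMap, outSum_componentMap]
  have hm := fun j => 𝒢.measurable_edgeFun hΔ hf' j
  rw [lintegral_finsetSum _ fun j _ => show Measurable fun x => 𝒢.edgeFun hΔ _ j (𝒢.inv j x) from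
      (hm j).comp (𝒢.measurePreserving j).measurable,
    lintegral_finsetSum _ fun j _ => hm j]
  -- Invariance of `μ` under `i_j` equates the terms with index `j`.
  exact Finset.sum_congr rfl fun j _ => (𝒢.measurePreserving j).lintegral_comp (hm j)

end

end MeasurableGraphing

theorem mainTheorem2 {X : Type u} [MeasurableSpace X] [MeasurableSpace.CountablySeparated X]
    (𝒢 : MeasurableGraphing X) (Δ : ℕ) (hΔ : 𝒢.DegreeLE Δ) :
    Measurable (𝒢.componentMap hΔ) ∧ IsProbabilityMeasure (𝒢.law hΔ) ∧
      Gr.IsUnimodular (𝒢.law hΔ) := by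
  have hφ := 𝒢.measurable_componentMap hΔ
  have := 𝒢.isProbabilityMeasure
  exact ⟨hφ, Measure.isProbabilityMeasure_map hφ.aemeasurable, 𝒢.isUnimodular_law hΔ⟩
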